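/- Let $K$ be a field of characteristic zero and let $n,m\in\mathbb{N}$ be such that $n\nmid m$ and $m\nmid n$. For a commutative $K$-algebra $D$, an element $F_{1-n}\in D$ and elements $\lambda_0=1,\lambda_1,\dots,\lambda_{m+n-2}$ of $K$, a Laurent series $C\in D((x^{-1}))$ is called a solution of the system $S(n,m,(\lambda_i),F_{1-n})$ if it has the form $$C=x+C_{-1}x^{-1}+C_{-2}x^{-2}+\cdots\qquad (C_{-i}\in D)$$ and there exist $P,Q\in D[x]$ and $F\in D[[x^{-1}]]$ of the form $F=F_{1-n}x^{1-n}+F_{-n}x^{-n}+F_{-1-n}x^{-1-n}+\cdots$ such that $$P=C^n\qquad\text{and}\qquad Q=\sum_{i=0}^{m+n-2}\lambda_iC^{m-i}+F.$$ The homogeneous system $S(n,m,F_{1-n})$ is the system $S(n,m,(\lambda_i),F_{1-n})$ with $\lambda_i=0$ for all $i>0$ (and $\lambda_0=1$). Theorem. Let $C\in K[Y]((x^{-1}))$ be a solution of the homogeneous system $S(n,m,Y^{m+n-1})$ (so $D=K[Y]$ and $F_{1-n}=Y^{m+n-1}$). Then for each $k=1,\dots,m+n-2$ there exists $c_{-k}\in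 K$ such that $$C_{-k}=c_{-k}Y^{k+1}.$$ -/

import Mathlib

namespace InverseLaurent

/-- The ring `D((x⁻¹))` of formal Laurent series in `x⁻¹`: the variable of `LaurentSeries D`
plays the role of `x⁻¹`. -/
abbrev InvLaurent (D : Type*) [CommRing D] : Type _ := LaurentSeries D

/-- The element `x` of `D((x⁻¹))`. -/
noncomputable def x (D : Type*) [CommRing D] : InvLaurent D := HahnSeries.single (-1 : ℤ) (1 : D)

/-- `xCoeff E k` is the coefficient `E_k` of `x ^ k` in `E ∈ D((x⁻¹))`. -/
def xCoeff {D : Type*} [CommRing D] (E : InvLaurent D) (k : ℤ) : D :=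
  HahnSeries.coeff E (-k)

/-- The inclusion `D[x] → D((x⁻¹))`. -/
noncomputable def ofPoly {D : Type*} [CommRing D] (P : Polynomial D) : InvLaurent D :=
  Polynomial.eval₂ HahnSeries.C (x D) P

/-- `C` has the form `x + C₋₁ x⁻¹ + C₋₂ x⁻² + ⋯`. -/
def HasNormalForm {D : Type*} [CommRing D] (C : InvLaurent D) : Prop :=
  (∀ k : ℤ, 1 < k → xCoeff C k = 0) ∧ xCoeff C 1 = 1 ∧ xCoeff C 0 = 0

/-- Integer powers of an invertible element of `D((x⁻¹))`. -/
noncomputable def intPow {D : Type*} [CommRing D] (C : InvLaurent D) (j : ℤ) : InvLaurent D :=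
  C ^ j.toNat * Ring.inverse C ^ (-j).toNat

/-- A series of the form `x + C₋₁ x⁻¹ + ⋯` is invertible, so that `intPow` yields its genuine
integer powers. -/
theorem HasNormalForm.isUnit {D : Type*} [CommRing D] {C : InvLaurent D}
    (hC : HasNormalForm C) : IsUnit C := by
  obtain ⟨h1, h2, -⟩ := hC
  have h : IsUnit (HahnSeries.single (1 : ℤ) (1 : D) * C) := by
    apply HahnSeries.isUnit_of_orderTop_pos
    by_contra hlt
    have hle := not_lt.mp hlt
    have hlt1 : (HahnSeries.single (1 : ℤ) (1 : D) * C - 1).orderTop < ((1 : ℤ) : WithTop ℤ) :=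
      lt_of_le_of_lt hle (by exact_mod_cast Int.zero_lt_one)
    obtain ⟨j, hj, hne⟩ := HahnSeries.orderTop_lt_iff_exists.mp hlt1
    apply hne
    have hj1 : j < 1 := by exact_mod_cast hj
    have hc : (HahnSeries.single (1 : ℤ) (1 : D) * C).coeff j = xCoeff C (1 - j) := by
      rw [HahnSeries.coeff_single_mul, one_mul, xCoeff, neg_sub]
    rw [HahnSeries.coeff_sub, hc, HahnSeries.coeff_one]
    by_cases hj0 : j = 0
    · subst hj0
      simp [h2]
    · rw [h1 (1 - j) (by omega), if_neg hj0, sub_zero]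
  exact isUnit_of_mul_isUnit_right h

/-- `C` is a solution of the system `S(n, m, (λ_i), F_{1-n})` over the commutative `K`-algebra `D`,
where `lam i` is `λ_i` for `0 ≤ i ≤ m + n - 2` (other values of `lam` are not used) and `f` is
`F_{1-n}`. The conditions on `F` say that `F = F_{1-n} x^{1-n} + F_{-n} x^{-n} + ⋯`. -/
def IsSolution {K D : Type*} [Field K] [CommRing D] [Algebra K D]
    (n m : ℕ) (lam : ℕ → K) (f : D) (C : InvLaurent D) : Prop :=
  lam 0 = 1 ∧ HasNormalForm C ∧
    ∃ (P Q : Polynomial D) (F : InvLaurent D),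
      (∀ k : ℤ, 1 - (n : ℤ) < k → xCoeff F k = 0) ∧ xCoeff F (1 - (n : ℤ)) = f ∧
      ofPoly P = C ^ n ∧
      ofPoly Q =
        (∑ i ∈ Finset.range (m + n - 1),
          HahnSeries.C (algebraMap K D (lam i)) * intPow C ((m : ℤ) - (i : ℤ))) + F

/-- The homogeneous system `S(n, m, F_{1-n})`: the system `S(n, m, (λ_i), F_{1-n})` with `λ_0 = 1`
and `λ_i = 0` for all `i ≠ 0`. -/
def IsHomogeneousSolution (K : Type*) {D : Type*} [Field K] [CommRing D] [Algebra K D]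
    (n m : ℕ) (f : D) (C : InvLaurent D) : Prop :=
  IsSolution n m (fun i => if i = 0 then (1 : K) else 0) f C

end InverseLaurent

/-! Give `x` and `Y` degree 1 and let θ = x∂/∂x + Y∂/∂Y. It suffices that θC = C: comparing
coefficients of x^(-k) then gives Y·C₋ₖ' = (k+1)C₋ₖ, so C₋ₖ is a multiple of Y^(k+1). Here P = Cⁿ
and Q = Cᵐ + F. In J = m·xP'·Q - n·P·xQ' the contributions of Cᵐ cancel, so J has degree at most 1
in x; it is also a polynomial without constant term, so J = n(m+n-1)Y^(m+n-1)·x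
(`jacobian_eq_single`), and θJ = (m+n)J. Put p = θP - nP, q = θQ - mQ and g = m·p·Q - n·P·q.
Homogeneity of J yields (m+n)J·p = (m+n)xP'·g - n·P·xg' (`jacobian_mul_deviation`). Comparing
degrees in x forces g = 0, hence p = 0 (`deviation_eq_zero`). Since p = n·Cⁿ⁻¹(θC - C), this gives
θC = C. -/

namespace InverseLaurent

/-! ### Degree bounds in x -/

section Support

variable {D : Type*} [CommRing D]

/-- `E` has no terms `x ^ k` with `k > -a`. -/
def VanishesBelow (E : InvLaurent D) (a : ℤ) : Prop := ∀ j < a, E.coeff j = 0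

/-- `E` has no terms `x ^ k` with `k < -a`. -/
def VanishesAbove (E : InvLaurent D) (a : ℤ) : Prop := ∀ j > a, E.coeff j = 0

namespace VanishesBelow

variable {E G : InvLaurent D} {a b : ℤ}

theorem mono (hE : VanishesBelow E a) (h : b ≤ a) : VanishesBelow E b :=
  fun j hj => hE j (by omega)

theorem add (hE : VanishesBelow E a) (hG : VanishesBelow G a) : VanishesBelow (E + G) a :=
  fun j hj => by simp [hE j hj, hG j hj]

theorem sub (hE : VanishesBelow E a) (hG : VanishesBelow G a) : VanishesBelow (E - G) a :=
  fun j hj => by simp [hE j hj, hG j hj]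

theorem mul (hE : VanishesBelow E a) (hG : VanishesBelow G b) :
    VanishesBelow (E * G) (a + b) := by
  intro j hj
  rw [HahnSeries.coeff_mul]
  refine Finset.sum_eq_zero fun ij hij => ?_
  obtain ⟨h1, h2, h3⟩ := Finset.mem_antidiagonal.mp hij
  by_cases h : ij.1 < a
  · rw [hE _ h, zero_mul]
  · rw [hG _ (by omega), mul_zero]

theorem coeff_mul_add (hE : VanishesBelow E a) (hG : VanishesBelow G b) :
    (E * G).coeff (a + b) = E.coeff a * G.coeff b := by
  rw [HahnSeries.coeff_mul]
  refine Finset.sum_eq_single (a, b) (fun ij hij hne => ?_) fun h => ?_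
  · obtain ⟨h1, h2, h3⟩ := Finset.mem_antidiagonal.mp hij
    rcases lt_trichotomy ij.1 a with h | h | h
    · rw [hE _ h, zero_mul]
    · exact absurd (Prod.ext h (by simp only; omega)) hne
    · rw [hG _ (by omega), mul_zero]
  · by_contra h0
    exact h (Finset.mem_antidiagonal.mpr ⟨left_ne_zero_of_mul h0, right_ne_zero_of_mul h0, rfl⟩)

theorem natCast_mul (c : ℕ) (hE : VanishesBelow E a) :
    VanishesBelow ((c : InvLaurent D) * E) a := by
  intro j hj
  rw [← nsmul_eq_mul, HahnSeries.coeff_nsmul, Pi.smul_apply, hE j hj, smul_zero]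

theorem pow_one_coeff (hE : VanishesBelow E a) (h1 : E.coeff a = 1) (n : ℕ) :
    VanishesBelow (E ^ n) (n * a) ∧ (E ^ n).coeff (n * a) = 1 := by
  induction n with
  | zero =>
    refine ⟨fun j hj => ?_, by simp⟩
    have : j ≠ 0 := by simp at hj; omega
    simp [HahnSeries.coeff_one, this]
  | succ n ih =>
    have e : ((n + 1 : ℕ) : ℤ) * a = n * a + a := by push_cast; ring
    rw [pow_succ, e]
    exact ⟨ih.1.mul hE, by rw [ih.1.coeff_mul_add hE, ih.2, h1, mul_one]⟩

end VanishesBelow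

namespace VanishesAbove

variable {E G : InvLaurent D} {a b : ℤ}

theorem sub (hE : VanishesAbove E a) (hG : VanishesAbove G a) : VanishesAbove (E - G) a :=
  fun j hj => by simp [hE j hj, hG j hj]

theorem mul (hE : VanishesAbove E a) (hG : VanishesAbove G b) :
    VanishesAbove (E * G) (a + b) := by
  intro j hj
  rw [HahnSeries.coeff_mul]
  refine Finset.sum_eq_zero fun ij hij => ?_
  obtain ⟨h1, h2, h3⟩ := Finset.mem_antidiagonal.mp hij
  by_cases h : a < ij.1
  · rw [hE _ h, zero_mul]
  · rw [hG _ (by omega), mul_zero]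

theorem natCast_mul (c : ℕ) (hE : VanishesAbove E a) :
    VanishesAbove ((c : InvLaurent D) * E) a := by
  intro j hj
  rw [← nsmul_eq_mul, HahnSeries.coeff_nsmul, Pi.smul_apply, hE j hj, smul_zero]

end VanishesAbove

theorem coeff_natCast_mul (c : ℕ) (E : InvLaurent D) (j : ℤ) :
    ((c : InvLaurent D) * E).coeff j = c * E.coeff j := by
  rw [← nsmul_eq_mul, HahnSeries.coeff_nsmul, Pi.smul_apply, nsmul_eq_mul]

theorem vanishesAbove_ofPoly (P : Polynomial D) : VanishesAbove (ofPoly P) 0 := by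
  intro j hj
  induction P using Polynomial.induction_on' with
  | add p q hp hq =>
    have : ofPoly (p + q) = ofPoly p + ofPoly q := Polynomial.eval₂_add ..
    rw [this, HahnSeries.coeff_add, hp, hq, add_zero]
  | monomial n a =>
    have : ofPoly (Polynomial.monomial n a) = HahnSeries.single (-n : ℤ) a := by
      simp [ofPoly, x, HahnSeries.C_apply, HahnSeries.single_pow]
    rw [this, HahnSeries.coeff_single_of_ne (by omega)]

end Support

/-! ### Euler derivations on Laurent series -/

section Euler

variable {R D : Type*} [CommRing R] [CommRing D] [Algebra R D]

/-- The derivation of `D((x⁻¹))` that acts as `δ` on coefficients and sends `x` to `x`. -/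
noncomputable def eulerDerivation (δ : Derivation R D D) : InvLaurent D →+ InvLaurent D where
  toFun E :=
    { coeff := fun j => δ (E.coeff j) - (j : D) * E.coeff j
      isPWO_support' := E.isPWO_support.mono fun j hj h => hj (by simp [h]) }
  map_zero' := by ext j; simp
  map_add' E G := by ext j; simp; ring

theorem coeff_eulerDerivation (δ : Derivation R D D) (E : InvLaurent D) (j : ℤ) :
    (eulerDerivation δ E).coeff j = δ (E.coeff j) - (j : D) * E.coeff j := rfl

theorem support_eulerDerivation_subset (δ : Derivation R D D) (E : InvLaurent D) :
    (eulerDerivation δ E).support ⊆ E.support :=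
  fun j hj h => hj (by simp [coeff_eulerDerivation, h])

theorem eulerDerivation_mul (δ : Derivation R D D) (E G : InvLaurent D) :
    eulerDerivation δ (E * G) = E * eulerDerivation δ G + eulerDerivation δ E * G := by
  ext j
  rw [HahnSeries.coeff_add, coeff_eulerDerivation, HahnSeries.coeff_mul,
    HahnSeries.coeff_mul_right' G.isPWO_support (support_eulerDerivation_subset δ G),
    HahnSeries.coeff_mul_left' E.isPWO_support (support_eulerDerivation_subset δ E),
    map_sum, Finset.mul_sum, ← Finset.sum_sub_distrib, ← Finset.sum_add_distrib]
  refine Finset.sum_congr rfl fun ij hij => ?_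
  obtain ⟨-, -, h⟩ := Finset.mem_antidiagonal.mp hij
  rw [← h, Derivation.leibniz, coeff_eulerDerivation, coeff_eulerDerivation]
  push_cast
  simp only [smul_eq_mul]
  ring

theorem eulerDerivation_single (δ : Derivation R D D) (j : ℤ) (a : D) :
    eulerDerivation δ (HahnSeries.single j a) = HahnSeries.single j (δ a - (j : D) * a) := by
  ext i
  rw [coeff_eulerDerivation]
  rcases eq_or_ne i j with rfl | h
  · simp
  · simp [HahnSeries.coeff_single_of_ne h]

theorem eulerDerivation_natCast (δ : Derivation R D D) (c : ℕ) :
    eulerDerivation δ (c : InvLaurent D) = 0 := by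
  rw [← map_natCast (HahnSeries.C : D →+* InvLaurent D), HahnSeries.C_apply,
    eulerDerivation_single]
  simp

theorem eulerDerivation_pow_succ (δ : Derivation R D D) (E : InvLaurent D) (k : ℕ) :
    eulerDerivation δ (E ^ (k + 1)) =
      ((k + 1 : ℕ) : InvLaurent D) * (E ^ k * eulerDerivation δ E) := by
  induction k with
  | zero => simp
  | succ k ih =>
    rw [pow_succ, eulerDerivation_mul, ih]
    push_cast
    ring

/-- The derivation `x d/dx` of `D((x⁻¹))`. -/
noncomputable abbrev xEuler (D : Type*) [CommRing D] : InvLaurent D →+ InvLaurent D :=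
  eulerDerivation (0 : Derivation D D D)

theorem eulerDerivation_comm (δ : Derivation R D D) (E : InvLaurent D) :
    eulerDerivation δ (xEuler D E) = xEuler D (eulerDerivation δ E) := by
  ext j
  simp [coeff_eulerDerivation]
  ring

theorem VanishesBelow.euler {E : InvLaurent D} {a : ℤ} (hE : VanishesBelow E a)
    (δ : Derivation R D D) : VanishesBelow (eulerDerivation δ E) a :=
  fun j hj => by simp [coeff_eulerDerivation, hE j hj]

theorem VanishesAbove.euler {E : InvLaurent D} {a : ℤ} (hE : VanishesAbove E a)
    (δ : Derivation R D D) : VanishesAbove (eulerDerivation δ E) a :=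
  fun j hj => by simp [coeff_eulerDerivation, hE j hj]

/-- The operator x d/dx kills the constant term. -/
theorem VanishesAbove.euler_zero {E : InvLaurent D} (hE : VanishesAbove E 0) :
    VanishesAbove (xEuler D E) (-1) := fun j hj => by
  rcases eq_or_ne j 0 with rfl | h
  · simp [coeff_eulerDerivation]
  · simp [coeff_eulerDerivation, hE j (by omega)]

end Euler

theorem natCast_ne_zero {D : Type*} [CommRing D] [CharZero D] {c : ℕ} (hc : c ≠ 0) : (c : InvLaurent D) ≠ 0 := fun h => by
  have h2 := coeff_natCast_mul (D := D) c 1 0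
  rw [h] at h2
  exact hc (by simpa using h2.symm)

/-! ### The Jacobian combination and its rigidity -/

section Jacobian

variable {R D : Type*} [CommRing R] [CommRing D] [Algebra R D]

/-- The combination `m x P' Q - n x P Q'`. -/
noncomputable def jacobian (n m : ℕ) (P Q : InvLaurent D) : InvLaurent D :=
  m * (xEuler D P * Q) - n * (P * xEuler D Q)

/-- Two bounds meet: polynomiality leaves only exponents of x at least 1, and cancellation of Cᵐ
leaves only exponents at most 1. -/
theorem jacobian_eq_single {n m : ℕ} (hn : 1 ≤ n) (hm : 1 ≤ m) {C F : InvLaurent D}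
    (hC : VanishesBelow C (-1)) (hC1 : C.coeff (-1) = 1)
    (hF : VanishesBelow F (n - 1)) (hP : VanishesAbove (C ^ n) 0)
    (hQ : VanishesAbove (C ^ m + F) 0) :
    jacobian n m (C ^ n) (C ^ m + F) =
      HahnSeries.single (-1) (n * (m + n - 1) * F.coeff (n - 1) : D) := by
  have hAbove : VanishesAbove (jacobian n m (C ^ n) (C ^ m + F)) (-1) :=
    ((hP.euler_zero.mul hQ).natCast_mul m).sub ((hP.mul hQ.euler_zero).natCast_mul n)
  obtain ⟨k, rfl⟩ : ∃ k, n = k + 1 := ⟨n - 1, by omega⟩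
  obtain ⟨l, rfl⟩ : ∃ l, m = l + 1 := ⟨m - 1, by omega⟩
  have key : jacobian (k + 1) (l + 1) (C ^ (k + 1)) (C ^ (l + 1) + F) =
      ((l + 1 : ℕ) : InvLaurent D) * (xEuler D (C ^ (k + 1)) * F) -
        ((k + 1 : ℕ) : InvLaurent D) * (C ^ (k + 1) * xEuler D F) := by
    simp only [jacobian, map_add, eulerDerivation_pow_succ]
    ring
  obtain ⟨hb, hb1⟩ := hC.pow_one_coeff hC1 (k + 1)
  have e : ((k + 1 : ℕ) : ℤ) * (-1) + (((k + 1 : ℕ) : ℤ) - 1) = -1 := by ring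
  have h1 := (hb.euler (0 : Derivation D D D)).mul hF
  have h2 := hb.mul (hF.euler (0 : Derivation D D D))
  have c1 := (hb.euler (0 : Derivation D D D)).coeff_mul_add hF
  have c2 := hb.coeff_mul_add (hF.euler (0 : Derivation D D D))
  rw [e] at h1 h2 c1 c2
  have hBelow : VanishesBelow (jacobian (k + 1) (l + 1) (C ^ (k + 1)) (C ^ (l + 1) + F)) (-1) := by
    rw [key]
    exact (h1.natCast_mul _).sub (h2.natCast_mul _)
  ext j
  rcases lt_trichotomy j (-1) with h | rfl | h
  · rw [hBelow j h, HahnSeries.coeff_single_of_ne h.ne]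
  · rw [key, HahnSeries.coeff_single_same, HahnSeries.coeff_sub, coeff_natCast_mul,
      coeff_natCast_mul, c1, c2, coeff_eulerDerivation, coeff_eulerDerivation, hb1]
    simp
    ring
  · rw [hAbove j h, HahnSeries.coeff_single_of_ne h.ne']

/-- If the Jacobian combination is homogeneous of degree `m + n`, then the deviations of `P` and
`Q` from homogeneity satisfy a first order linear equation. -/
theorem jacobian_mul_deviation (δ : Derivation R D D) {n m : ℕ} {P Q p q : InvLaurent D}
    (hp : eulerDerivation δ P = p + n * P) (hq : eulerDerivation δ Q = q + m * Q)
    (hW : eulerDerivation δ (jacobian n m P Q) = (m + n) * jacobian n m P Q) :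
    (m + n) * (jacobian n m P Q * p) =
      (m + n) * (xEuler D P * (m * (p * Q) - n * (P * q))) -
        n * (P * xEuler D (m * (p * Q) - n * (P * q))) := by
  simp only [jacobian, map_sub, map_add, eulerDerivation_mul, eulerDerivation_natCast,
    eulerDerivation_comm, hp, hq, zero_mul, add_zero] at hW ⊢
  -- `hW` is a linear equation in p, q and their derivatives; the factor nP makes it possible to
  -- absorb q into m·p·Q - n·P·q.
  linear_combination ((n : InvLaurent D) * P) * hW

/-- If g ≠ 0 had degree d in x, then 0 ≤ d ≤ m+n-2, and the right side of the equation would have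
the nonzero coefficient n(m+n-d)·g_d at x^(n+d), while the left side has degree at most n-1. -/
theorem deviation_eq_zero [IsDomain D] [CharZero D] (δ : Derivation R D D) {n m : ℕ} (hn : 1 ≤ n)
    {P Q p q : InvLaurent D} {w : D} (hw : w ≠ 0)
    (hp : eulerDerivation δ P = p + n * P) (hq : eulerDerivation δ Q = q + m * Q)
    (hJ : jacobian n m P Q = HahnSeries.single (-1) w)
    (hW : eulerDerivation δ (jacobian n m P Q) = (m + n) * jacobian n m P Q)
    (hP : VanishesBelow P (-n)) (hP1 : P.coeff (-n) = 1) (hQ : VanishesBelow Q (-m))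
    (hpb : VanishesBelow p (2 - n)) (hqb : VanishesBelow q (2 - m))
    (hPa : VanishesAbove P 0) (hQa : VanishesAbove Q 0)
    (hpa : VanishesAbove p 0) (hqa : VanishesAbove q 0) : p = 0 := by
  have key := jacobian_mul_deviation δ hp hq hW
  have hmn : ((m : InvLaurent D) + n) ≠ 0 := by
    rw [← Nat.cast_add]
    exact natCast_ne_zero (by omega)
  set g := (m : InvLaurent D) * (p * Q) - n * (P * q) with hg
  have hga : VanishesAbove g 0 := ((hpa.mul hQa).natCast_mul m).sub ((hPa.mul hqa).natCast_mul n)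
  have hgb : VanishesBelow g (2 - n - m) :=
    (((hpb.mul hQ).mono (by omega)).natCast_mul m).sub
      (((hP.mul hqb).mono (by omega)).natCast_mul n)
  have hg0 : g = 0 := by
    by_contra hne
    have ho : g.coeff g.order ≠ 0 := HahnSeries.coeff_order_eq_zero.not.mpr hne
    have hob : VanishesBelow g g.order := fun j hj => HahnSeries.coeff_eq_zero_of_lt_order hj
    have ho0 : g.order ≤ 0 := by
      by_contra h
      exact ho (hga _ (by omega))
    have hoe : 2 - n - m ≤ g.order := by
      by_contra h
      exact ho (hgb _ (by omega))
    have hl : VanishesBelow (((m + n : ℕ) : InvLaurent D) * (jacobian n m P Q * p)) (1 - n) := by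
      have hs : VanishesBelow (HahnSeries.single (-1) w) (-1) :=
        fun j hj => HahnSeries.coeff_single_of_ne hj.ne
      rw [hJ]
      exact ((hs.mul hpb).mono (by omega)).natCast_mul _
    have c := congrArg (fun E : InvLaurent D => E.coeff (-n + g.order)) key
    rw [← Nat.cast_add] at c
    simp only [HahnSeries.coeff_sub] at c
    rw [hl _ (by omega), coeff_natCast_mul, coeff_natCast_mul, (hP.euler (0 : Derivation D D D)).coeff_mul_add hob,
      hP.coeff_mul_add (hob.euler (0 : Derivation D D D)), coeff_eulerDerivation, coeff_eulerDerivation, hP1] at c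
    -- Since d = -`g.order` is at most m+n-2, the integer factor is positive.
    have c' : (((n : ℤ) * (m + n + g.order) : ℤ) : D) * g.coeff g.order = 0 := by
      rw [c]
      simp
      ring
    rcases mul_eq_zero.mp c' with h | h
    · rcases mul_eq_zero.mp (Int.cast_eq_zero.mp h) with h | h <;> omega
    · exact ho h
  rw [hg0] at key
  simp only [map_zero, mul_zero, sub_zero] at key
  have hs : (HahnSeries.single (-1) w : InvLaurent D) ≠ 0 := HahnSeries.single_ne_zero hw
  rw [hJ] at key
  exact ((mul_eq_zero.mp ((mul_eq_zero.mp key).resolve_left hmn)).resolve_left hs)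

end Jacobian

/-! ### Homogeneity of the solution -/

section Homogeneous

open Polynomial

/-- The derivation `Y d/dY` of `K[Y]`. -/
noncomputable def polyEuler (K : Type*) [Field K] : Derivation K K[X] K[X] :=
  (X : K[X]) • Polynomial.derivative'

theorem polyEuler_apply {K : Type*} [Field K] (f : K[X]) : polyEuler K f = X * derivative f := rfl

theorem polyEuler_X_pow {K : Type*} [Field K] (d : ℕ) :
    polyEuler K (X ^ d : K[X]) = (d : K[X]) * X ^ d := by
  rw [polyEuler_apply, derivative_X_pow]
  cases d with
  | zero => simp
  | succ d => rw [Nat.add_sub_cancel, pow_succ]; simp; ring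

theorem eq_C_mul_X_pow_of_polyEuler {K : Type*} [Field K] [CharZero K] {f : K[X]} {d : ℕ}
    (h : polyEuler K f = d * f) : f = C (f.coeff d) * X ^ d := by
  ext j
  rw [coeff_C_mul_X_pow]
  split_ifs with hj
  · rw [hj]
  · have hc := congrArg (fun g => coeff g j) h
    have h2 : (polyEuler K f).coeff j = j * f.coeff j := by
      rw [polyEuler_apply]
      cases j with
      | zero => simp
      | succ j => rw [coeff_X_mul, coeff_derivative]; push_cast; ring
    simp only [h2, Polynomial.coeff_natCast_mul] at hc
    have h3 : ((j : K) - d) * f.coeff j = 0 := by linear_combination hc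
    exact (mul_eq_zero.mp h3).resolve_left (sub_ne_zero.mpr (by exact_mod_cast hj))

/-- A homogeneous solution is homogeneous of degree `1` for the grading with `deg x = deg Y = 1`. -/
theorem IsHomogeneousSolution.euler_eq {K : Type*} [Field K] [CharZero K] {n m : ℕ} (hn : 2 ≤ n)
    (hm : 2 ≤ m) {C : InvLaurent K[X]}
    (hC : IsHomogeneousSolution K n m ((X : K[X]) ^ (m + n - 1)) C) :
    eulerDerivation (polyEuler K) C = C := by
  obtain ⟨-, ⟨hC1, hC2, hC3⟩, P, Q, F, hF, hF1, hP, hQ⟩ := hC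
  have hCb : VanishesBelow C (-1) := fun j hj => by simpa [xCoeff] using hC1 (-j) (by omega)
  have hCc : C.coeff (-1) = 1 := hC2
  have hC0 : C.coeff 0 = 0 := by simpa [xCoeff] using hC3
  have hFb : VanishesBelow F (n - 1) := fun j hj => by simpa [xCoeff] using hF (-j) (by omega)
  have hFc : F.coeff (n - 1) = X ^ (m + n - 1) := by rw [← hF1, xCoeff, neg_sub]
  have hQ' : ofPoly Q = C ^ m + F := by
    rw [hQ, Finset.sum_eq_single_of_mem 0 (by simp; omega) (fun i _ hi => by simp [hi])]
    simp [intPow]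
  have hPa : VanishesAbove (C ^ n) 0 := hP ▸ vanishesAbove_ofPoly P
  have hQa : VanishesAbove (C ^ m + F) 0 := hQ' ▸ vanishesAbove_ofPoly Q
  have hJ := jacobian_eq_single (by omega) (by omega) hCb hCc hFb hPa hQa
  rw [hFc] at hJ
  set θ := eulerDerivation (polyEuler K) with hθ
  -- The term x is fixed by θ and C₀ = 0; this gain of two degrees over C gives the bounds `2 - n`
  -- and `2 - m`.
  have hγ : VanishesBelow (θ C - C) 1 := by
    intro j hj
    rw [HahnSeries.coeff_sub, hθ, coeff_eulerDerivation]
    rcases lt_trichotomy j (-1) with h | rfl | h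
    · simp [hCb j h]
    · simp [hCc]
    · obtain rfl : j = 0 := by omega
      simp [hC0]
  have hpow : ∀ r : ℕ, 1 ≤ r →
      θ (C ^ r) - r * C ^ r = r * (C ^ (r - 1) * (θ C - C)) := by
    intro r hr
    obtain ⟨k, rfl⟩ : ∃ k, r = k + 1 := ⟨r - 1, by omega⟩
    rw [hθ, eulerDerivation_pow_succ, Nat.add_sub_cancel]
    ring
  have hdev : ∀ r : ℕ, 1 ≤ r → VanishesBelow (D := K[X]) (θ (C ^ r) - r * C ^ r) (2 - r) := by
    intro r hr
    rw [hpow r hr]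
    exact ((((hCb.pow_one_coeff hCc (r - 1)).1).mul hγ).mono (by omega)).natCast_mul _
  obtain ⟨hPb, hPc⟩ := hCb.pow_one_coeff hCc n
  rw [mul_neg_one] at hPb hPc
  have hQb : VanishesBelow (C ^ m + F) (-m) :=
    ((hCb.pow_one_coeff hCc m).1.mono (by omega)).add (hFb.mono (by omega))
  have hcast : (n : K[X]) * (m + n - 1) = ((n * (m + n - 1) : ℕ) : K[X]) := by
    rw [Nat.cast_mul, Nat.cast_sub (by omega)]
    push_cast
    ring
  have hp0 : θ (C ^ n) - n * C ^ n = 0 := by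
    refine deviation_eq_zero (polyEuler K) (n := n) (m := m) (Q := C ^ m + F)
      (q := θ (C ^ m + F) - m * (C ^ m + F))
      (by omega) ?_ (by ring) (by ring) hJ ?_ hPb hPc hQb
      (hdev n (by omega)) ?_ hPa hQa ((hPa.euler _).sub (hPa.natCast_mul n))
      ((hQa.euler _).sub (hQa.natCast_mul m))
    · rw [hcast]
      exact mul_ne_zero (Nat.cast_ne_zero.mpr (Nat.mul_ne_zero (by omega) (by omega)))
        (pow_ne_zero _ X_ne_zero)
    · rw [hJ]
      rw [eulerDerivation_single, ← Nat.cast_add (R := InvLaurent K[X])]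
      ext1; funext j
      rw [InverseLaurent.coeff_natCast_mul, HahnSeries.coeff_single, HahnSeries.coeff_single]
      split_ifs
      · rw [hcast, Derivation.leibniz, Derivation.map_natCast, polyEuler_X_pow,
          Nat.cast_sub (by omega)]
        push_cast
        simp only [smul_eq_mul]
        ring
      · rw [mul_zero]
    · have e : θ (C ^ m + F) - m * (C ^ m + F) = (θ (C ^ m) - m * C ^ m) + (θ F - m * F) := by
        rw [map_add]; ring
      rw [e]
      exact (hdev m (by omega)).add
        (((hFb.euler _).sub (hFb.natCast_mul m)).mono (by omega))
  rw [hpow n (by omega)] at hp0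
  have hC0 : C ≠ 0 := fun h => by simp [h] at hCc
  have hn0 : (n : InvLaurent K[X]) ≠ 0 := natCast_ne_zero (by omega)
  exact sub_eq_zero.mp
    ((mul_eq_zero.mp ((mul_eq_zero.mp hp0).resolve_left hn0)).resolve_left (pow_ne_zero _ hC0))

end Homogeneous

end InverseLaurent

theorem mainTheorem5 {K : Type*} [Field K] [CharZero K] (n m : ℕ)
    (hnm : ¬ n ∣ m) (hmn : ¬ m ∣ n)
    (C : InverseLaurent.InvLaurent (Polynomial K))
    (hC : InverseLaurent.IsHomogeneousSolution K n m
      ((Polynomial.X : Polynomial K) ^ (m + n - 1)) C) :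
    ∀ k : ℕ, 1 ≤ k → k ≤ m + n - 2 →
      ∃ c : K, InverseLaurent.xCoeff C (-(k : ℤ)) = Polynomial.C c * Polynomial.X ^ (k + 1) := by
  intro k _ _
  -- Non-divisibility enters only through n, m ≥ 2.
  have aux : ∀ a b : ℕ, ¬ a ∣ b → ¬ b ∣ a → 2 ≤ a := fun a b h1 h2 => by
    rcases a with _ | _ | a
    · simp at h2
    · simp at h1
    · omega
  have h := hC.euler_eq (aux n m hnm hmn) (aux m n hmn hnm)
  refine ⟨(InverseLaurent.xCoeff C (-(k : ℤ))).coeff (k + 1),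
    InverseLaurent.eq_C_mul_X_pow_of_polyEuler ?_⟩
  have hc := congrArg (fun E : InverseLaurent.InvLaurent (Polynomial K) => E.coeff k) h
  simp only [InverseLaurent.coeff_eulerDerivation, Int.cast_natCast] at hc
  rw [InverseLaurent.xCoeff, neg_neg]
  push_cast
  linear_combination hc
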